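/- **Universal approximation in Gaussian Sobolev spaces.** Let $k\in\mathbb N=\{0,1,2,\dots\}$ and $1\le p<\infty$. *Finite-dimensional Sobolev density.* For a finite Borel measure $\nu$ on $\mathbb R^N$ and $f\in C^k(\mathbb R^N,\mathbb R^{N'})$ put $$\|f\|_{\mathcal W^{k,p}_\nu}:=\max_{0\le i\le k}\Big(\int_{\mathbb R^N}\|D^if(y)\|^p\,d\nu(y)\Big)^{1/p}$$ (operator norms of multilinear maps, Euclidean norms on $\mathbb R^N,\mathbb R^{N'}$), and let $C^{k;p}_\nu(\mathbb R^N,\mathbb R^{N'})$ be the set of $f\in C^k(\mathbb R^N,\mathbb R^{N'})$ with $\|f\|_{\mathcal W^{k,p}_\nu}<\infty$. For all $N,N'\in\mathbb N$ let $\{f^{N,\theta,N'}\}_{\theta\in\Theta_{N,N'}}$ be a family in $C^k(\mathbb R^N,\mathbb R^{N'})$ such that for every finite Borel measure $\nu$ on $\mathbb R^N$, every $g\in C^{k;p}_\nu(\mathbb R^N,\mathbb R^{N'})$ and every $\epsilon>0$ there is $\theta\in\Theta_{N,N'}$ with $\|g-f^{N,\theta,N'}\|_{\mathcal W^{k,p}_\nu}<\epsilon$.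 *Spaces and architectures.* Let $X$ be a real Banach space, $Y$ a real Hilbert space, and $\mu^0$ a Gaussian measure on $X$, i.e. a Borel probability measure such that every $\ell\in X^*$ has a (possibly degenerate) Gaussian law under $\mu^0$. Let $\mathcal A_{ED}(X,Y)$ be the set of encoder–decoder architectures $F^{\mathcal E,\theta,\mathcal D}(x)=\mathcal D f^{N,\theta,N'}(\mathcal E x)$, where $N,N'\in\mathbb N$, $\mathcal E\in\mathcal L(X,\mathbb R^N)$, $\mathcal D\in\mathcal L(\mathbb R^{N'},Y)$, $\theta\in\Theta_{N,N'}$. *Gaussian Sobolev space.* Let $X^*_{\mu^0}$ be the closure of $\{\ell-\int\ell\,d\mu^0:\ell\in X^*\}$ in $L^2(\mu^0)$. The Cameron–Martin space $X_{\mu^0}$ consists of the $h\in X$ for which there is a (necessarily unique) $\hat h\in X^*_{\mu^0}$ with $\ell(h)=\langle \ell-\int\ell\,d\mu^0,\hat h\rangle_{L^2(\mu^0)}$ for all $\ell\in X^*$; it is a Hilbert space with $\langle h_1,h_2\rangle:=\langle\hat h_1,\hat h_2\rangle_{L^2(\mu^0)}$. Let $\mathcal L_2^i(X_{\mu^0},Y)$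 be the space of $i$-linear Hilbert–Schmidt maps ($\mathcal L_2^0:=Y$), and write $D^i_{\mu^0}F(x)$ for the restriction of $D^iF(x)$ to $(X_{\mu^0})^i$ ($D^0_{\mu^0}F:=F$). Let $W^{k,p}_{\mu^0}(X,Y)$ be the completion, under the norm $$\|F\|_{W^{k,p}_{\mu^0}(X,Y)}=\max_{0\le i\le k}\Big(\int_X\|D^i_{\mu^0}F(x)\|^p_{\mathcal L^i_2(X_{\mu^0},Y)}\,d\mu^0(x)\Big)^{1/p},$$ of the maps $x\mapsto \mathcal D f(\mathcal E x)$ with $\mathcal E\in\mathcal L(X,\mathbb R^N)$, $\mathcal D\in\mathcal L(\mathbb R^{N'},Y)$ and $f\in C_b^\infty(\mathbb R^N,\mathbb R^{N'})$ (bounded with all derivatives), $N,N'\in\mathbb N$; that is, the closure of the tuples $(F,D_{\mu^0}F,\dots,D^k_{\mu^0}F)$ of these maps in $\prod_{i=0}^kL^p(\mu^0;\mathcal L_2^i(X_{\mu^0},Y))$. A map $F$ is identified with its tuple. *Claim.* The encoder–decoder architectures are dense in $W^{k,p}_{\mu^0}(X,Y)$: (i) every $F^{\mathcal E,\theta,\mathcal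 D}\in\mathcal A_{ED}(X,Y)$ with $f^{N,\theta,N'}\in C^{k;p}_{\nu}(\mathbb R^N,\mathbb R^{N'})$ for $\nu=\mathcal E_\#\mu^0$ belongs to $W^{k,p}_{\mu^0}(X,Y)$ (so $\mathcal A_{ED}(X,Y)\subset W^{k,p}_{\mu^0}(X,Y)$ if all $f^{N,\theta,N'}$ lie in $C^{k;p}_\nu(\mathbb R^N,\mathbb R^{N'})$ for every finite $\nu$); (ii) for every $w\in W^{k,p}_{\mu^0}(X,Y)$ and $\epsilon>0$ there is $F\in\mathcal A_{ED}(X,Y)\cap W^{k,p}_{\mu^0}(X,Y)$ with $\|w-F\|_{W^{k,p}_{\mu^0}(X,Y)}<\epsilon$. -/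

import Mathlib

open MeasureTheory ProbabilityTheory Filter
open scoped ENNReal Topology InnerProductSpace

noncomputable section

namespace GaussianUA

/-! ### Hilbert-Schmidt multilinear maps -/

section HilbertSchmidt

variable (H : Type*) [NormedAddCommGroup H] [InnerProductSpace ℝ H] [CompleteSpace H]
variable (Y : Type*) [NormedAddCommGroup Y] [InnerProductSpace ℝ Y]

/-- Index set of a fixed orthonormal (Hilbert) basis of `H`. -/
def BasisIndex : Type _ := (exists_hilbertBasis ℝ H).choose

/-- A fixed orthonormal (Hilbert) basis of `H`. -/
def stdBasis : HilbertBasis (BasisIndex H) ℝ H := (exists_hilbertBasis ℝ H).choose_spec.choose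

variable {H Y} in
/-- A continuous multilinear map into a Hilbert space which vanishes on all tuples of vectors of an
orthonormal basis is zero. -/
theorem eq_zero_of_basis {i : ℕ} (L : ContinuousMultilinearMap ℝ (fun _ : Fin i => H) Y)
    (h : ∀ j : Fin i → BasisIndex H, L (fun a => stdBasis H (j a)) = 0) : L = 0 := by
  classical
  have key : ∀ s : Finset (Fin i), ∀ m : Fin i → H,
      (∀ a, a ∉ s → m a ∈ Set.range (stdBasis H)) → L m = 0 := by
    intro s
    induction s using Finset.induction_on with
    | empty =>
      intro m hm
      choose j hj using fun a => hm a (Finset.notMem_empty a)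
      rw [← h j]
      congr 1
      funext a
      exact (hj a).symm
    | insert a s _ ih =>
      intro m hm
      have hz : L.toContinuousLinearMap m a = 0 := by
        refine ContinuousLinearMap.ext_on (s := Set.range (stdBasis H)) ?_ ?_
        · have hd := (stdBasis H).dense_span
          exact (Submodule.dense_iff_topologicalClosure_eq_top).2 hd
        · intro x hx
          simp only [ContinuousMultilinearMap.toContinuousLinearMap_apply, zero_apply]
          apply ih
          intro c hc
          by_cases hca : c = a
          · subst hca
            simpa using hx
          · rw [Function.update_of_ne hca]
            exact hm c (by simp [hca, hc])
      have hz' := congrArg (fun T : H →L[ℝ] Y => T (m a)) hz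
      simpa using hz'
  ext m
  exact key Finset.univ m (fun a ha => absurd (Finset.mem_univ a) ha)

/-- The space `𝓛₂ⁱ(H, Y)` of `i`-linear Hilbert-Schmidt maps, as a subspace of the bounded
`i`-linear maps: those `L` with `∑_{j₁,…,jᵢ} ‖L(e_{j₁},…,e_{jᵢ})‖² < ∞` for an orthonormal basis
`e` of `H` (neither this condition nor the value of the sum depends on the basis). -/
def hsSubmodule (i : ℕ) : Submodule ℝ (ContinuousMultilinearMap ℝ (fun _ : Fin i => H) Y) where
  carrier := {L | Memℓp (fun j : Fin i → BasisIndex H => L (fun a => stdBasis H (j a))) 2}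
  add_mem' hL hM := Memℓp.add hL hM
  zero_mem' := zero_memℓp
  smul_mem' c _ hL := Memℓp.const_smul hL c

/-- `𝓛₂ⁱ(H, Y)` as a type of its own, since it carries the Hilbert-Schmidt norm and not the
operator norm. -/
def HSMultilinear (i : ℕ) : Type _ := hsSubmodule H Y i

namespace HSMultilinear

variable {H Y} {i : ℕ}

instance : AddCommGroup (HSMultilinear H Y i) := inferInstanceAs (AddCommGroup (hsSubmodule H Y i))

instance : Module ℝ (HSMultilinear H Y i) := inferInstanceAs (Module ℝ (hsSubmodule H Y i))

/-- The underlying continuous multilinear map. -/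
def toMultilinear (L : HSMultilinear H Y i) : ContinuousMultilinearMap ℝ (fun _ : Fin i => H) Y :=
  L.1

/-- The array of coordinates `L(e_{j₁},…,e_{jᵢ})`, as an element of `ℓ²`. -/
def coords : HSMultilinear H Y i →ₗ[ℝ] lp (fun _ : Fin i → BasisIndex H => Y) 2 where
  toFun L := ⟨fun j => L.toMultilinear (fun a => stdBasis H (j a)), L.2⟩
  map_add' _ _ := rfl
  map_smul' _ _ := rfl

theorem coords_injective : Function.Injective (coords : HSMultilinear H Y i →ₗ[ℝ] _) := by
  rw [injective_iff_map_eq_zero]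
  intro L hL
  apply Subtype.ext
  apply eq_zero_of_basis
  intro j
  exact congrFun (congrArg Subtype.val hL) j

/-- The Hilbert-Schmidt norm `(∑_{j₁,…,jᵢ} ‖L(e_{j₁},…,e_{jᵢ})‖²)^{1/2}`. -/
instance : NormedAddCommGroup (HSMultilinear H Y i) :=
  NormedAddCommGroup.induced _ _ coords coords_injective

theorem norm_sq_eq (L : HSMultilinear H Y i) :
    ‖L‖ ^ 2 = ∑' j : Fin i → BasisIndex H, ‖L.toMultilinear (fun a => stdBasis H (j a))‖ ^ 2 := by
  have h := lp.norm_rpow_eq_tsum (p := 2) (by norm_num) (coords L)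
  simp only [ENNReal.toReal_ofNat, Real.rpow_ofNat] at h
  exact h

end HSMultilinear

end HilbertSchmidt

/-! ### The Cameron-Martin space of a Gaussian measure -/

section CameronMartin

variable {X : Type*} [NormedAddCommGroup X] [NormedSpace ℝ X] [MeasurableSpace X] [BorelSpace X]
variable (γ : Measure X) [IsGaussian γ]

theorem memLp_centered (ℓ : StrongDual ℝ X) : MemLp (fun x => ℓ x - ∫ z, ℓ z ∂γ) 2 γ :=
  (IsGaussian.memLp_dual γ ℓ 2 (by simp)).sub (memLp_const _)

/-- The linear map `ℓ ↦ ℓ - ∫ ℓ dγ` from `X*` to `L²(γ)`. -/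
def centered : StrongDual ℝ X →ₗ[ℝ] Lp ℝ 2 γ where
  toFun ℓ := (memLp_centered γ ℓ).toLp _
  map_add' ℓ m := by
    rw [← MemLp.toLp_add]
    apply MemLp.toLp_congr
    refine Eventually.of_forall fun x => ?_
    have : ∫ z, (ℓ + m) z ∂γ = ∫ z, ℓ z ∂γ + ∫ z, m z ∂γ :=
      integral_add (IsGaussian.integrable_dual γ ℓ) (IsGaussian.integrable_dual γ m)
    rw [Pi.add_apply, this]
    change ℓ x + m x - _ = _
    ring
  map_smul' c ℓ := by
    rw [RingHom.id_apply, ← MemLp.toLp_const_smul]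
    apply MemLp.toLp_congr
    refine Eventually.of_forall fun x => ?_
    have : ∫ z, (c • ℓ) z ∂γ = c * ∫ z, ℓ z ∂γ := integral_const_mul c _
    rw [Pi.smul_apply, this, smul_eq_mul]
    change c * ℓ x - _ = _
    ring

/-- `X*_γ`: the closure in `L²(γ)` of the centered continuous linear functionals. -/
def dualClosure : Submodule ℝ (Lp ℝ 2 γ) := (LinearMap.range (centered γ)).topologicalClosure

/-- The Cameron-Martin space `X_γ`. A vector `h : X` lies in the Cameron-Martin space iff there is
`g ∈ X*_γ` with `ℓ(h) = ⟪ℓ - ∫ ℓ dγ, g⟫_{L²(γ)}` for all `ℓ ∈ X*`; such a `g` is unique, it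
determines `h`, and the Cameron-Martin inner product of `h₁, h₂` is `⟪g₁, g₂⟫_{L²(γ)}`. The space
is realised here as the set of these `g`, with the inner product of `L²(γ)`; the
inclusion `g ↦ h` into `X` is `cameronMartinIncl`. -/
def cameronMartin : Submodule ℝ (Lp ℝ 2 γ) where
  carrier := {g | g ∈ dualClosure γ ∧ ∃ h : X, ∀ ℓ : StrongDual ℝ X, ℓ h = ⟪centered γ ℓ, g⟫_ℝ}
  add_mem' := by
    rintro g₁ g₂ ⟨hg₁, h₁, e₁⟩ ⟨hg₂, h₂, e₂⟩
    refine ⟨add_mem hg₁ hg₂, h₁ + h₂, fun ℓ => ?_⟩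
    rw [map_add, e₁, e₂, inner_add_right]
  zero_mem' := ⟨zero_mem _, 0, fun ℓ => by simp⟩
  smul_mem' := by
    rintro c g ⟨hg, h, e⟩
    refine ⟨Submodule.smul_mem _ c hg, c • h, fun ℓ => ?_⟩
    rw [map_smul, e, inner_smul_right, smul_eq_mul]

/-- The vector `h` of `X` that corresponds to an element `g` of `cameronMartin γ`. -/
def cameronMartinVec (g : cameronMartin γ) : X := g.2.2.choose

theorem cameronMartinVec_spec (g : cameronMartin γ) (ℓ : StrongDual ℝ X) :
    ℓ (cameronMartinVec γ g) = ⟪centered γ ℓ, (g : Lp ℝ 2 γ)⟫_ℝ := g.2.2.choose_spec ℓ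

theorem exists_norm_cameronMartinVec_le :
    ∃ C : ℝ, ∀ g : cameronMartin γ, ‖cameronMartinVec γ g‖ ≤ C * ‖g‖ := by
  have hbs : ∃ C', ∀ g : {g : cameronMartin γ // ‖g‖ ≤ 1},
      ‖NormedSpace.inclusionInDoubleDual ℝ X (cameronMartinVec γ g.1)‖ ≤ C' := by
    apply banach_steinhaus
    intro ℓ
    refine ⟨‖centered γ ℓ‖, fun g => ?_⟩
    rw [NormedSpace.dual_def, cameronMartinVec_spec]
    calc ‖⟪centered γ ℓ, (g.1 : Lp ℝ 2 γ)⟫_ℝ‖ ≤ ‖centered γ ℓ‖ * ‖(g.1 : Lp ℝ 2 γ)‖ :=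
          norm_inner_le_norm _ _
      _ ≤ ‖centered γ ℓ‖ * 1 := by
          gcongr
          exact g.2
      _ = ‖centered γ ℓ‖ := mul_one _
  obtain ⟨C, hC⟩ := hbs
  refine ⟨C, fun g => ?_⟩
  have hsmul : ∀ (c : ℝ) (g : cameronMartin γ),
      cameronMartinVec γ (c • g) = c • cameronMartinVec γ g := by
    intro c g
    refine (SeparatingDual.eq_iff_forall_dual_eq (R := ℝ)).2 fun ℓ => ?_
    rw [cameronMartinVec_spec, map_smul, cameronMartinVec_spec, Submodule.coe_smul,
      inner_smul_right, smul_eq_mul]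
  by_cases hg : ‖g‖ = 0
  · have hg0 : g = (0 : ℝ) • g := by
      rw [zero_smul]; exact norm_eq_zero.1 hg
    rw [hg, hg0, hsmul]
    simp
  · have hpos : 0 < ‖g‖ := lt_of_le_of_ne (norm_nonneg _) (Ne.symm hg)
    have h1 := hC ⟨‖g‖⁻¹ • g, by rw [norm_smul, norm_inv, norm_norm, inv_mul_cancel₀ hg]⟩
    have h2 : ‖cameronMartinVec γ (‖g‖⁻¹ • g)‖ ≤ C := by
      rw [← (NormedSpace.inclusionInDoubleDualLi (𝕜 := ℝ) (E := X)).norm_map]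
      exact h1
    rw [hsmul, norm_smul, norm_inv, norm_norm, inv_mul_le_iff₀ hpos] at h2
    linarith

/-- The inclusion `X_γ → X`. -/
def cameronMartinIncl : cameronMartin γ →L[ℝ] X :=
  LinearMap.mkContinuousOfExistsBound
    { toFun := cameronMartinVec γ
      map_add' := fun g₁ g₂ => by
        refine (SeparatingDual.eq_iff_forall_dual_eq (R := ℝ)).2 fun ℓ => ?_
        rw [cameronMartinVec_spec, map_add, cameronMartinVec_spec, cameronMartinVec_spec,
          Submodule.coe_add, inner_add_right]
      map_smul' := fun c g => by
        refine (SeparatingDual.eq_iff_forall_dual_eq (R := ℝ)).2 fun ℓ => ?_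
        rw [cameronMartinVec_spec, RingHom.id_apply, map_smul, cameronMartinVec_spec,
          Submodule.coe_smul, inner_smul_right, smul_eq_mul] }
    (exists_norm_cameronMartinVec_le γ)

theorem cameronMartinIncl_spec (g : cameronMartin γ) (ℓ : StrongDual ℝ X) :
    ℓ (cameronMartinIncl γ g) = ⟪centered γ ℓ, (g : Lp ℝ 2 γ)⟫_ℝ := cameronMartinVec_spec γ g ℓ

theorem cameronMartinIncl_injective : Function.Injective (cameronMartinIncl γ) := by
  rw [injective_iff_map_eq_zero]
  intro g hg
  have horth : (g : Lp ℝ 2 γ) ∈ (LinearMap.range (centered γ))ᗮ := by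
    rw [Submodule.mem_orthogonal]
    rintro _ ⟨ℓ, rfl⟩
    rw [← cameronMartinIncl_spec, hg, map_zero]
  rw [← Submodule.orthogonal_closure] at horth
  have h0 : ⟪(g : Lp ℝ 2 γ), (g : Lp ℝ 2 γ)⟫_ℝ = 0 :=
    (Submodule.mem_orthogonal _ _).1 horth _ g.2.1
  exact Subtype.ext (inner_self_eq_zero.1 h0)

/-- The Cameron-Martin space is a Hilbert space. -/
instance [CompleteSpace X] : CompleteSpace (cameronMartin γ) := by
  suffices hcl : IsClosed (cameronMartin γ : Set (Lp ℝ 2 γ)) from hcl.completeSpace_coe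
  refine isClosed_of_closure_subset fun g hg => ?_
  obtain ⟨u, hu, hlim⟩ := mem_closure_iff_seq_limit.1 hg
  have hdc : IsClosed (dualClosure γ : Set (Lp ℝ 2 γ)) := Submodule.isClosed_topologicalClosure _
  refine ⟨hdc.mem_of_tendsto hlim (Eventually.of_forall fun n => (hu n).1), ?_⟩
  let v : ℕ → cameronMartin γ := fun n => ⟨u n, hu n⟩
  have hv : CauchySeq v := by
    have h1 : CauchySeq u := hlim.cauchySeq
    rw [Metric.cauchySeq_iff] at h1 ⊢
    exact h1
  have hv' : CauchySeq fun n => cameronMartinIncl γ (v n) :=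
    (cameronMartinIncl γ).uniformContinuous.comp_cauchySeq hv
  obtain ⟨h, hh⟩ := cauchySeq_tendsto_of_complete hv'
  refine ⟨h, fun ℓ => ?_⟩
  have t1 : Tendsto (fun n => ℓ (cameronMartinIncl γ (v n))) atTop (𝓝 (ℓ h)) :=
    (ℓ.continuous.tendsto h).comp hh
  have t2 : Tendsto (fun n => ⟪centered γ ℓ, u n⟫_ℝ) atTop (𝓝 ⟪centered γ ℓ, g⟫_ℝ) :=
    tendsto_const_nhds.inner hlim
  refine tendsto_nhds_unique t1 (t2.congr fun n => ?_)
  exact (cameronMartinIncl_spec γ (v n) ℓ).symm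

end CameronMartin

/-! ### Cylindrical maps and encoder-decoder architectures -/

/-- `ℝᴺ` with its Euclidean norm. -/
abbrev Euc (N : ℕ) : Type := EuclideanSpace ℝ (Fin N)

section Maps

variable {X : Type*} [NormedAddCommGroup X] [NormedSpace ℝ X]
variable {Y : Type*} [NormedAddCommGroup Y] [NormedSpace ℝ Y]

/-- The map `x ↦ D (f (E x))` given by an encoder `E`, a decoder `D` and a map `f` between
Euclidean spaces. -/
def cylMap {N N' : ℕ} (E : X →L[ℝ] Euc N) (D : Euc N' →L[ℝ] Y) (f : Euc N → Euc N') : X → Y :=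
  fun x => D (f (E x))

/-- `C_b^∞`: smooth maps that are bounded together with their derivatives of every order. -/
def IsSmoothBounded {N N' : ℕ} (f : Euc N → Euc N') : Prop :=
  ContDiff ℝ (⊤ : ℕ∞) f ∧ ∀ i : ℕ, ∃ C : ℝ, ∀ x, ‖iteratedFDeriv ℝ i f x‖ ≤ C

variable (X Y) in
/-- The set of smooth bounded cylindrical maps `C^∞_{b,Cyl}(X, Y)`. -/
def smoothCyl : Set (X → Y) :=
  {F | ∃ (N N' : ℕ) (E : X →L[ℝ] Euc N) (D : Euc N' →L[ℝ] Y) (f : Euc N → Euc N'),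
    IsSmoothBounded f ∧ F = cylMap E D f}

variable (X Y) in
/-- The set `𝓐_ED(X, Y)` of encoder-decoder architectures built on the parametrised
finite-dimensional maps `f N N' θ : ℝᴺ → ℝᴺ'`. -/
def encoderDecoder {Θ : ℕ → ℕ → Type*} (f : ∀ N N' : ℕ, Θ N N' → Euc N → Euc N') : Set (X → Y) :=
  {F | ∃ (N N' : ℕ) (E : X →L[ℝ] Euc N) (D : Euc N' →L[ℝ] Y) (θ : Θ N N'),
    F = cylMap E D (f N N' θ)}

end Maps

/-! ### Finite-dimensional Sobolev spaces and density -/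

/-- The Sobolev norm `max_{i ≤ k} (∫ ‖Dⁱf‖^p dν)^{1/p}` (possibly infinite), where `‖Dⁱf(x)‖` is
the operator norm of the `i`-linear map `Dⁱf(x)`. -/
def sobolevNorm (k : ℕ) (p : ℝ≥0∞) {N N' : ℕ} (ν : Measure (Euc N)) (f : Euc N → Euc N') : ℝ≥0∞ :=
  ⨆ i : Fin (k + 1), eLpNorm (fun x => iteratedFDeriv ℝ (i : ℕ) f x) p ν

/-- `C^{k;p}_ν(ℝᴺ, ℝᴺ')`: the `C^k` maps with finite Sobolev norm. -/
def MemSobolev (k : ℕ) (p : ℝ≥0∞) {N N' : ℕ} (ν : Measure (Euc N)) (f : Euc N → Euc N') : Prop :=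
  ContDiff ℝ k f ∧ sobolevNorm k p ν f < ⊤

/-- Universal approximation in Sobolev norms in finite dimensions: for all `N, N'` and every finite
measure `ν` on `ℝᴺ`, the family of `C^k` maps `f N N' θ` approximates every element of
`C^{k;p}_ν(ℝᴺ, ℝᴺ')` in the Sobolev norm. -/
structure FinDimSobolevDensity (k : ℕ) (p : ℝ≥0∞) {Θ : ℕ → ℕ → Type*}
    (f : ∀ N N' : ℕ, Θ N N' → Euc N → Euc N') : Prop where
  contDiff : ∀ (N N' : ℕ) (θ : Θ N N'), ContDiff ℝ k (f N N' θ)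
  approx : ∀ (N N' : ℕ) (ν : Measure (Euc N)), IsFiniteMeasure ν →
    ∀ g : Euc N → Euc N', MemSobolev k p ν g → ∀ ε : ℝ, 0 < ε →
      ∃ θ : Θ N N', sobolevNorm k p ν (fun x => g x - f N N' θ x) < ENNReal.ofReal ε

/-! ### The Gaussian Sobolev space -/

section GaussianSobolev

variable {X : Type*} [NormedAddCommGroup X] [NormedSpace ℝ X] [CompleteSpace X]
  [MeasurableSpace X] [BorelSpace X]
variable (Y : Type*) [NormedAddCommGroup Y] [InnerProductSpace ℝ Y]
variable (γ : Measure X) [IsGaussian γ] (k : ℕ) (p : ℝ≥0∞) [Fact (1 ≤ p)]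

/-- The product `∏_{i ≤ k} L^p(γ; 𝓛₂ⁱ(X_γ, Y))` with the maximum norm; the factor `i = 0` is
`L^p(γ; Y)`. -/
abbrev JetSpace : Type _ :=
  ∀ i : Fin (k + 1), Lp (HSMultilinear (cameronMartin γ) Y (i : ℕ)) p γ

variable {Y γ k p}

/-- `w` is the jet `(F, D_γ F, …, D_γ^k F)` of the map `F`, where `D_γ^i F(x)` is the restriction of
the Fréchet derivative `DⁱF(x)` to the Cameron-Martin space. Thus the norm of `w` is
`max_{i ≤ k} (∫ ‖D_γ^i F(x)‖_{𝓛₂ⁱ(X_γ,Y)}^p dγ(x))^{1/p}`. -/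
def IsJetOf (w : JetSpace Y γ k p) (F : X → Y) : Prop :=
  ∀ i : Fin (k + 1), ∀ᵐ x ∂γ, (w i x).toMultilinear =
    (iteratedFDeriv ℝ (i : ℕ) F x).compContinuousLinearMap (fun _ => cameronMartinIncl γ)

variable (Y γ k p)

/-- The Gaussian Sobolev space `W^{k,p}_γ(X, Y)`: the completion of the smooth bounded cylindrical
maps under the norm `max_{i ≤ k} (∫ ‖D_γ^i F(x)‖_{𝓛₂ⁱ(X_γ,Y)}^p dγ(x))^{1/p}`, realised as the
closure of their jets. -/
def gaussianSobolev : Set (JetSpace Y γ k p) :=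
  closure {w | ∃ F ∈ smoothCyl X Y, IsJetOf w F}

end GaussianSobolev

end GaussianUA

end

/-!
# Density of encoder-decoder architectures in Gaussian Sobolev spaces

For a cylindrical map `F = D ∘ f ∘ E` with `f` of class `C^k`, the chain rule gives
`D_γ^i F(x) = D ∘ Dⁱf(E x) ∘ (E ι × ⋯ × E ι)`, where `ι` is the inclusion of the Cameron-Martin
space. The operator `E ι` maps a Hilbert space into `ℝᴺ`, so it is Hilbert-Schmidt by Bessel's
inequality, and `M ↦ D ∘ M ∘ (E ι × ⋯ × E ι)` is a bounded linear map `hsComp` into the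
Hilbert-Schmidt multilinear maps (`exists_norm_hsComp_le`). Hence, for fixed `E` and `D`, passing
from `f` to the jet of `D ∘ f ∘ E` is defined on all `f` of finite Sobolev norm with respect to the
law of `E` (`exists_isJetOf_cylMap`), and it is Lipschitz for that norm
(`exists_norm_sub_le_of_isJetOf`).

This reduces both assertions to finite dimensions. An architecture lies in the Gaussian Sobolev
space because smooth bounded maps are dense in the `C^k` maps of finite Sobolev norm for any finite
measure (`MemSobolev.exists_isSmoothBounded`), as one sees by cutting off at a large radius and then
mollifying. Conversely, an element of the Gaussian Sobolev space is close to the jet of some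
`D ∘ g ∘ E` with `g` smooth and bounded, and `g` is replaced by an approximating member of the given
family, keeping `E` and `D`.
-/

namespace GaussianUA

/-! ### Mollification of compactly supported maps -/

section Mollification

open scoped Convolution

universe u

variable {E : Type u} [NormedAddCommGroup E] [NormedSpace ℝ E] [FiniteDimensional ℝ E]
  [MeasurableSpace E] [BorelSpace E] (μ : Measure E) [μ.IsAddHaarMeasure]

/-- Convolution with a bump function commutes with differentiation of the other factor. -/
theorem fderiv_normed_convolution {F : Type*} [NormedAddCommGroup F] [NormedSpace ℝ F]
    (φ : ContDiffBump (0 : E)) {g : E → F}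
    (hg : HasCompactSupport g) (hg1 : ContDiff ℝ 1 g) :
    fderiv ℝ (φ.normed μ ⋆[ContinuousLinearMap.lsmul ℝ ℝ, μ] g) =
      φ.normed μ ⋆[ContinuousLinearMap.lsmul ℝ ℝ, μ] fderiv ℝ g := by
  ext1 x
  rw [(hg.hasFDerivAt_convolution_right (ContinuousLinearMap.lsmul ℝ ℝ)
    φ.continuous_normed.locallyIntegrable hg1 x).fderiv]
  rfl

/-- Mollification approximates a compactly supported `C^n` map uniformly in the `n`-th
derivative. By induction on `n`: mollification commutes with the derivative. -/
theorem exists_norm_iteratedFDeriv_convolution_sub_le (n : ℕ) :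
    ∀ {F : Type u} [NormedAddCommGroup F] [NormedSpace ℝ F] [CompleteSpace F] {g : E → F},
      HasCompactSupport g → ContDiff ℝ n g → ∀ ε : ℝ, 0 < ε → ∃ δ : ℝ, 0 < δ ∧
        ∀ φ : ContDiffBump (0 : E), φ.rOut ≤ δ → ∀ x,
          ‖iteratedFDeriv ℝ n (φ.normed μ ⋆[ContinuousLinearMap.lsmul ℝ ℝ, μ] g) x -
            iteratedFDeriv ℝ n g x‖ ≤ ε := by
  induction n with
  | zero =>
    intro F _ _ _ g hg hgc ε hε
    obtain ⟨δ, hδ, h⟩ := Metric.uniformContinuous_iff.1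
      (hg.uniformContinuous_of_continuous hgc.continuous) ε hε
    refine ⟨δ, hδ, fun φ hφ x => ?_⟩
    rw [iteratedFDeriv_zero_eq_comp, iteratedFDeriv_zero_eq_comp, Function.comp_apply,
      Function.comp_apply, ← map_sub, LinearIsometryEquiv.norm_map, ← dist_eq_norm]
    refine φ.dist_normed_convolution_le hgc.continuous.aestronglyMeasurable fun y hy => ?_
    exact (h ((Metric.mem_ball.1 hy).trans_le hφ)).le
  | succ n ih =>
    intro F _ _ _ g hg hgc ε hε
    have hg1 : ContDiff ℝ 1 g := hgc.of_le (by exact_mod_cast Nat.le_add_left 1 n)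
    obtain ⟨δ, hδ, h⟩ := ih (hg.fderiv ℝ)
      (hgc.fderiv_right (m := n) (by push_cast; exact le_rfl)) ε hε
    refine ⟨δ, hδ, fun φ hφ x => ?_⟩
    rw [iteratedFDeriv_succ_eq_comp_right, iteratedFDeriv_succ_eq_comp_right,
      Function.comp_apply, Function.comp_apply, ← dist_eq_norm, LinearIsometryEquiv.dist_map,
      dist_eq_norm, fderiv_normed_convolution μ φ hg hg1]
    exact h φ hφ x

/-- A compactly supported `C^k` map is the uniform limit, with all derivatives up to order `k`, of
compactly supported smooth maps. -/
theorem exists_contDiff_norm_iteratedFDeriv_sub_le {F : Type u} [NormedAddCommGroup F]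
    [NormedSpace ℝ F] [CompleteSpace F] {k : ℕ} {g : E → F} (hg : HasCompactSupport g)
    (hgk : ContDiff ℝ k g) {ε : ℝ} (hε : 0 < ε) :
    ∃ h : E → F, HasCompactSupport h ∧ ContDiff ℝ (⊤ : ℕ∞) h ∧
      ∀ i ≤ k, ∀ x, ‖iteratedFDeriv ℝ i h x - iteratedFDeriv ℝ i g x‖ ≤ ε := by
  have key : ∀ i : Fin (k + 1), _ := fun i =>
    exists_norm_iteratedFDeriv_convolution_sub_le (Measure.addHaar (G := E)) i hg
      (hgk.of_le (by exact_mod_cast i.is_le)) ε hε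
  choose δ hδ h using key
  obtain ⟨r, hr, hrδ⟩ : ∃ r : ℝ, 0 < r ∧ ∀ i, r ≤ δ i :=
    ⟨Finset.univ.inf' Finset.univ_nonempty δ, by simpa [Finset.lt_inf'_iff] using hδ,
      fun i => Finset.inf'_le _ (Finset.mem_univ i)⟩
  let φ : ContDiffBump (0 : E) := ⟨r / 2, r, by positivity, by linarith⟩
  refine ⟨φ.normed Measure.addHaar ⋆[ContinuousLinearMap.lsmul ℝ ℝ, Measure.addHaar] g,
    φ.hasCompactSupport_normed.convolution _ hg,
    φ.hasCompactSupport_normed.contDiff_convolution_left _ φ.contDiff_normed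
      hgk.continuous.locallyIntegrable, fun i hi x => ?_⟩
  exact h ⟨i, Nat.lt_succ_of_le hi⟩ φ (hrδ _) x

end Mollification

/-! ### Cut-off in Sobolev norms -/

section Cutoff

/-- Dominated convergence in `L^p`. -/
theorem tendsto_eLpNorm_zero_of_dominated {α G : Type*} [MeasurableSpace α] {μ : Measure α}
    [NormedAddCommGroup G] {p : ℝ≥0∞} (hp0 : p ≠ 0) (hp : p ≠ ∞) {F : ℕ → α → G} {b : α → ℝ}
    (hF : ∀ n, AEStronglyMeasurable (F n) μ) (hb : eLpNorm b p μ < ∞)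
    (hle : ∀ n x, ‖F n x‖ ≤ b x) (hlim : ∀ x, Tendsto (fun n => F n x) atTop (𝓝 0)) :
    Tendsto (fun n => eLpNorm (F n) p μ) atTop (𝓝 0) := by
  have hp' : 0 < p.toReal := ENNReal.toReal_pos hp0 hp
  simp only [eLpNorm_eq_lintegral_rpow_enorm_toReal hp0 hp]
  have h0 : (0 : ℝ≥0∞) = 0 ^ (1 / p.toReal) := by
    rw [ENNReal.zero_rpow_of_pos (by positivity)]
  rw [h0]
  refine Tendsto.ennrpow_const _ ?_
  have h1 : (0 : ℝ≥0∞) = ∫⁻ _, 0 ∂μ := by simp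
  rw [h1]
  refine tendsto_lintegral_of_dominated_convergence' (fun x => ‖b x‖ₑ ^ p.toReal)
    (fun n => (hF n).enorm.pow_const _) (fun n => ae_of_all _ fun x => ?_)
    (lintegral_rpow_enorm_lt_top_of_eLpNorm_lt_top hp0 hp hb).ne (ae_of_all _ fun x => ?_)
  · refine ENNReal.rpow_le_rpow ?_ hp'.le
    rw [enorm_le_iff_norm_le]
    exact (hle n x).trans (le_abs_self _)
  · have h2 : Tendsto (fun n => ‖F n x‖ₑ ^ p.toReal) atTop (𝓝 (‖(0 : G)‖ₑ ^ p.toReal)) :=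
      ((hlim x).enorm).ennrpow_const _
    rwa [enorm_zero, ENNReal.zero_rpow_of_pos hp'] at h2

variable {E : Type*} [NormedAddCommGroup E] [NormedSpace ℝ E] [FiniteDimensional ℝ E]

/-- The smooth cut-off functions `x ↦ χ(x / (n + 1))`, where `χ` equals `1` on the unit ball and
vanishes outside the ball of radius `2`. -/
noncomputable def cutoff (E : Type*) [NormedAddCommGroup E] [NormedSpace ℝ E]
    [FiniteDimensional ℝ E] (n : ℕ) (x : E) : ℝ :=
  (⟨1, 2, one_pos, one_lt_two⟩ : ContDiffBump (0 : E)) (((n : ℝ) + 1)⁻¹ • x)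

theorem contDiff_cutoff (n : ℕ) {m : ℕ∞} : ContDiff ℝ m (cutoff E n) :=
  (ContDiffBump.contDiff _).comp (contDiff_const_smul _)

theorem hasCompactSupport_cutoff (n : ℕ) : HasCompactSupport (cutoff E n) :=
  (ContDiffBump.hasCompactSupport _).comp_smul (inv_ne_zero (by positivity))

theorem cutoff_eq_one {n : ℕ} {x : E} (hx : ‖x‖ ≤ n + 1) : cutoff E n x = 1 := by
  apply ContDiffBump.one_of_mem_closedBall
  rw [mem_closedBall_zero_iff, norm_smul, norm_inv, Real.norm_of_nonneg (by positivity)]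
  exact inv_mul_le_one_of_le₀ hx (by positivity)

/-- Each derivative of the cut-off functions is bounded uniformly in `n`: the chain rule
contributes the factor `(n + 1)⁻ⁱ ≤ 1`. -/
theorem exists_norm_iteratedFDeriv_cutoff_le (i : ℕ) :
    ∃ C : ℝ, ∀ n x, ‖iteratedFDeriv ℝ i (cutoff E n) x‖ ≤ C := by
  let χ : ContDiffBump (0 : E) := ⟨1, 2, one_pos, one_lt_two⟩
  have hχ : ContDiff ℝ i χ := χ.contDiff
  obtain ⟨C, hC⟩ := (χ.hasCompactSupport.iteratedFDeriv (𝕜 := ℝ) i).exists_bound_of_continuous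
    (hχ.continuous_iteratedFDeriv le_rfl)
  refine ⟨C, fun n x => ?_⟩
  have h0 : cutoff E n = χ ∘ (((n : ℝ) + 1)⁻¹ • ContinuousLinearMap.id ℝ E) := rfl
  rw [h0, ContinuousLinearMap.iteratedFDeriv_comp_right _ hχ _ le_rfl]
  refine (ContinuousMultilinearMap.norm_compContinuousLinearMap_le _ _).trans ?_
  refine (mul_le_of_le_one_right (norm_nonneg _) ?_).trans (hC _)
  refine Finset.prod_le_one (fun _ _ => norm_nonneg _) fun _ _ => ?_
  refine ContinuousLinearMap.opNorm_le_bound _ zero_le_one fun y => ?_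
  rw [smul_apply, norm_smul, norm_inv, Real.norm_of_nonneg (by positivity)]
  refine mul_le_mul_of_nonneg_right ?_ (norm_nonneg y)
  exact inv_le_one_of_one_le₀ (by linarith [Nat.cast_nonneg (α := ℝ) n])

variable [MeasurableSpace E] [BorelSpace E] {F : Type*} [NormedAddCommGroup F] [NormedSpace ℝ F]

/-- Cutting off a `C^k` map converges in the Sobolev norm: the error vanishes on growing balls
and, by the Leibniz rule, is dominated by the derivatives of the map. -/
theorem tendsto_eLpNorm_iteratedFDeriv_cutoff_smul_sub {ν : Measure E} {k : ℕ} {p : ℝ≥0∞}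
    (hp1 : 1 ≤ p) (hp : p ≠ ∞) {f : E → F} (hf : ContDiff ℝ k f)
    (hfp : ∀ i ≤ k, eLpNorm (iteratedFDeriv ℝ i f) p ν < ∞) {i : ℕ} (hi : i ≤ k) :
    Tendsto (fun n => eLpNorm (fun x => iteratedFDeriv ℝ i (fun y => cutoff E n y • f y) x -
      iteratedFDeriv ℝ i f x) p ν) atTop (𝓝 0) := by
  choose C hC using fun j => exists_norm_iteratedFDeriv_cutoff_le (E := E) j
  have hik : (i : WithTop ℕ∞) ≤ k := by exact_mod_cast hi
  have hprod : ∀ n, ContDiff ℝ k (fun y => cutoff E n y • f y) := fun n =>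
    (contDiff_cutoff n (m := k)).smul hf
  have hmem : ∀ j ≤ k, MemLp (iteratedFDeriv ℝ j f) p ν := fun j hj =>
    ⟨(hf.continuous_iteratedFDeriv (by exact_mod_cast hj)).aestronglyMeasurable, hfp j hj⟩
  have hb : MemLp (fun x => (∑ j ∈ Finset.range (i + 1),
      ((i.choose j : ℝ) * C j) * ‖iteratedFDeriv ℝ (i - j) f x‖) + ‖iteratedFDeriv ℝ i f x‖) p ν :=
    (memLp_finsetSum _ fun j _ =>
      ((hmem (i - j) ((Nat.sub_le _ _).trans hi)).norm.const_mul _)).add (hmem i hi).norm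
  refine tendsto_eLpNorm_zero_of_dominated (zero_lt_one.trans_le hp1).ne' hp
    (fun n => ?_) hb.eLpNorm_lt_top (fun n x => ?_) fun x => ?_
  · exact (((hprod n).continuous_iteratedFDeriv hik).sub
      (hf.continuous_iteratedFDeriv hik)).aestronglyMeasurable
  · refine (norm_sub_le _ _).trans (add_le_add_left ?_ _)
    refine (norm_iteratedFDeriv_smul_le (contDiff_cutoff n (m := k)) hf x hik).trans ?_
    gcongr
    exact hC _ _ _
  · refine tendsto_const_nhds.congr' ?_
    obtain ⟨m, hm⟩ := exists_nat_gt ‖x‖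
    filter_upwards [eventually_ge_atTop m] with n hn
    have hx : ‖x‖ < (n : ℝ) + 1 := by
      have : (m : ℝ) ≤ n := by exact_mod_cast hn
      linarith
    have he : (fun y => cutoff E n y • f y) =ᶠ[𝓝 x] f := by
      filter_upwards [(continuous_norm.tendsto x).eventually (gt_mem_nhds hx)] with y hy
      rw [cutoff_eq_one (le_of_lt hy), one_smul]
    rw [he.iteratedFDeriv ℝ i |>.self_of_nhds, sub_self]

end Cutoff

/-! ### Density of smooth bounded maps in finite-dimensional Sobolev spaces -/

section Density

variable {k : ℕ} {p : ℝ≥0∞} {N N' : ℕ} {ν : Measure (Euc N)}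

theorem sobolevNorm_le_iff {f : Euc N → Euc N'} {c : ℝ≥0∞} :
    sobolevNorm k p ν f ≤ c ↔ ∀ i ≤ k, eLpNorm (iteratedFDeriv ℝ i f) p ν ≤ c := by
  rw [sobolevNorm, iSup_le_iff]
  exact ⟨fun h i hi => h ⟨i, Nat.lt_succ_of_le hi⟩, fun h i => h i i.is_le⟩

theorem eLpNorm_iteratedFDeriv_le_sobolevNorm (f : Euc N → Euc N') {i : ℕ} (hi : i ≤ k) :
    eLpNorm (iteratedFDeriv ℝ i f) p ν ≤ sobolevNorm k p ν f :=
  sobolevNorm_le_iff.1 le_rfl i hi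

theorem iteratedFDeriv_fun_sub {f g : Euc N → Euc N'} (hf : ContDiff ℝ k f) (hg : ContDiff ℝ k g)
    {i : ℕ} (hi : i ≤ k) : iteratedFDeriv ℝ i (fun x => f x - g x) =
      fun x => iteratedFDeriv ℝ i f x - iteratedFDeriv ℝ i g x := by
  have hik : (i : WithTop ℕ∞) ≤ k := by exact_mod_cast hi
  ext1 x
  exact iteratedFDeriv_sub_apply (hf.of_le hik).contDiffAt (hg.of_le hik).contDiffAt

theorem IsSmoothBounded.memSobolev [IsFiniteMeasure ν] {f : Euc N → Euc N'}
    (hf : IsSmoothBounded f) : MemSobolev k p ν f := by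
  refine ⟨hf.1.of_le (by exact_mod_cast le_top), ?_⟩
  refine (iSup_le fun i => Finset.single_le_sum
    (f := fun i : Fin (k + 1) => eLpNorm (fun x => iteratedFDeriv ℝ (i : ℕ) f x) p ν)
    (fun _ _ => zero_le) (Finset.mem_univ i)).trans_lt (ENNReal.sum_lt_top.2 fun i _ => ?_)
  obtain ⟨C, hC⟩ := hf.2 i
  have hcont : Continuous (iteratedFDeriv ℝ (i : ℕ) f) :=
    hf.1.continuous_iteratedFDeriv (by exact_mod_cast le_top)
  exact (MemLp.of_bound hcont.aestronglyMeasurable C (ae_of_all _ hC)).eLpNorm_lt_top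

theorem MemSobolev.of_sub {f g : Euc N → Euc N'} (hp1 : 1 ≤ p) (hf : MemSobolev k p ν f)
    (hg : ContDiff ℝ k g) (hfg : sobolevNorm k p ν (fun x => f x - g x) < ∞) :
    MemSobolev k p ν g := by
  refine ⟨hg, lt_of_le_of_lt (sobolevNorm_le_iff.2 fun i hi => ?_) (ENNReal.add_lt_top.2
    ⟨hf.2, hfg⟩)⟩
  have hik : (i : WithTop ℕ∞) ≤ k := by exact_mod_cast hi
  have hfc := hf.1.continuous_iteratedFDeriv hik
  have hgc := hg.continuous_iteratedFDeriv hik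
  have h0 : iteratedFDeriv ℝ i g =
      iteratedFDeriv ℝ i f - iteratedFDeriv ℝ i (fun x => f x - g x) := by
    rw [iteratedFDeriv_fun_sub hf.1 hg hi]
    ext1 x
    simp
  rw [h0]
  refine (eLpNorm_sub_le hfc.aestronglyMeasurable ?_ hp1).trans (add_le_add
    (eLpNorm_iteratedFDeriv_le_sobolevNorm f hi) (eLpNorm_iteratedFDeriv_le_sobolevNorm _ hi))
  rw [iteratedFDeriv_fun_sub hf.1 hg hi]
  exact (hfc.sub hgc).aestronglyMeasurable

/-- Smooth bounded maps are dense in the Sobolev space of a finite measure: cut off, then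
mollify. -/
theorem MemSobolev.exists_isSmoothBounded [IsFiniteMeasure ν] (hp1 : 1 ≤ p) (hp : p ≠ ∞)
    {f : Euc N → Euc N'} (hf : MemSobolev k p ν f) {ε : ℝ≥0∞} (hε : ε ≠ 0) :
    ∃ g : Euc N → Euc N', IsSmoothBounded g ∧ sobolevNorm k p ν (fun x => g x - f x) ≤ ε := by
  have hε2 : 0 < ε / 2 := ENNReal.half_pos hε
  have hcut : ∀ᶠ n in atTop, ∀ i ∈ Finset.range (k + 1),
      eLpNorm (fun x => iteratedFDeriv ℝ i (fun y => cutoff (Euc N) n y • f y) x -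
        iteratedFDeriv ℝ i f x) p ν ≤ ε / 2 := by
    rw [Finset.eventually_all]
    intro i hi
    have h := tendsto_eLpNorm_iteratedFDeriv_cutoff_smul_sub hp1 hp hf.1
      (fun i hi => (eLpNorm_iteratedFDeriv_le_sobolevNorm f hi).trans_lt hf.2)
      (Nat.lt_succ_iff.1 (Finset.mem_range.1 hi))
    filter_upwards [h.eventually (gt_mem_nhds hε2)] with n hn using hn.le
  obtain ⟨n, hn⟩ := hcut.exists
  set h : Euc N → Euc N' := fun y => cutoff (Euc N) n y • f y with hh
  have hhk : ContDiff ℝ k h := (contDiff_cutoff n (m := k)).smul hf.1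
  have hhc : HasCompactSupport h := (hasCompactSupport_cutoff n).smul_right
  -- A uniform error `δ` costs at most `ν(ℝᴺ)^{1/p} δ` in `L^p(ν)`.
  obtain ⟨δ, hδ, hδε⟩ : ∃ δ : ℝ, 0 < δ ∧
      ν Set.univ ^ p.toReal⁻¹ * ENNReal.ofReal δ ≤ ε / 2 := by
    have hlim : Tendsto (fun δ : ℝ => ν Set.univ ^ p.toReal⁻¹ * ENNReal.ofReal δ) (𝓝[>] 0)
        (𝓝 (ν Set.univ ^ p.toReal⁻¹ * ENNReal.ofReal 0)) :=
      ENNReal.Tendsto.const_mul ((ENNReal.continuous_ofReal.tendsto 0).mono_left nhdsWithin_le_nhds)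
        (Or.inr (ENNReal.rpow_ne_top_of_nonneg (by positivity) (measure_ne_top ν _)))
    rw [ENNReal.ofReal_zero, mul_zero] at hlim
    obtain ⟨δ, h1, h2⟩ := ((hlim.eventually (gt_mem_nhds hε2)).and self_mem_nhdsWithin).exists
    exact ⟨δ, h2, h1.le⟩
  obtain ⟨g, hgc, hg, hgh⟩ := exists_contDiff_norm_iteratedFDeriv_sub_le hhc hhk hδ
  have hgk : ContDiff ℝ k g := hg.of_le (by exact_mod_cast le_top)
  refine ⟨g, ⟨hg, fun i => (hgc.iteratedFDeriv (𝕜 := ℝ) i).exists_bound_of_continuous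
    (hg.continuous_iteratedFDeriv (by exact_mod_cast le_top))⟩,
    sobolevNorm_le_iff.2 fun i hi => ?_⟩
  have hik : (i : WithTop ℕ∞) ≤ k := by exact_mod_cast hi
  have hsplit : iteratedFDeriv ℝ i (fun x => g x - f x) =
      (fun x => iteratedFDeriv ℝ i g x - iteratedFDeriv ℝ i h x) +
        fun x => iteratedFDeriv ℝ i h x - iteratedFDeriv ℝ i f x := by
    rw [iteratedFDeriv_fun_sub hgk hf.1 hi]
    ext1 x
    simp
  rw [hsplit, ← ENNReal.add_halves ε]
  have hcont := fun {u : Euc N → Euc N'} (hu : ContDiff ℝ k u) =>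
    hu.continuous_iteratedFDeriv hik
  refine (eLpNorm_add_le ((hcont hgk).sub (hcont hhk)).aestronglyMeasurable
    ((hcont hhk).sub (hcont hf.1)).aestronglyMeasurable hp1).trans (add_le_add ?_ ?_)
  · exact (eLpNorm_le_of_ae_bound (ae_of_all _ (hgh i hi))).trans hδε
  · exact hn i (Finset.mem_range.2 (Nat.lt_succ_of_le hi))

end Density

/-! ### Finite-rank operators and Hilbert-Schmidt multilinear maps -/

section FiniteRank

variable {H : Type*} [NormedAddCommGroup H] [InnerProductSpace ℝ H] [CompleteSpace H]
variable {Y : Type*} [NormedAddCommGroup Y] [InnerProductSpace ℝ Y]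

/-- A bounded operator into a Euclidean space is Hilbert-Schmidt: its coordinates are represented
by vectors of `H`, to which Bessel's inequality applies. -/
theorem summable_norm_sq_stdBasis {N : ℕ} (T : H →L[ℝ] Euc N) :
    Summable fun j => ‖T (stdBasis H j)‖ ^ 2 := by
  simp only [EuclideanSpace.norm_sq_eq]
  refine summable_sum fun n _ => ?_
  let v : H := (InnerProductSpace.toDual ℝ H).symm ((EuclideanSpace.proj n).comp T)
  have hv : ∀ x, T x n = ⟪v, x⟫_ℝ := fun x =>
    (InnerProductSpace.toDual_symm_apply (x := x) (y := (EuclideanSpace.proj n).comp T)).symm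
  simpa only [hv, real_inner_comm] using (stdBasis H).orthonormal.inner_products_summable v

/-- Sums over multi-indices of products are bounded by powers of the one-index sum: enlarge the
index set to a box and factor. -/
theorem sum_prod_le_tsum_pow {ι : Type*} {a : ι → ℝ} (ha : ∀ j, 0 ≤ a j) (hs : Summable a) (i : ℕ)
    (s : Finset (Fin i → ι)) : ∑ j ∈ s, ∏ b, a (j b) ≤ (∑' j, a j) ^ i := by
  classical
  let t : Finset ι := s.biUnion fun j => Finset.univ.image j
  have hst : s ⊆ Fintype.piFinset fun _ : Fin i => t := fun j hj =>
    Fintype.mem_piFinset.2 fun b => Finset.mem_biUnion.2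
      ⟨j, hj, Finset.mem_image_of_mem _ (Finset.mem_univ b)⟩
  calc ∑ j ∈ s, ∏ b, a (j b)
      ≤ ∑ j ∈ Fintype.piFinset fun _ : Fin i => t, ∏ b, a (j b) :=
        Finset.sum_le_sum_of_subset_of_nonneg hst fun j _ _ => Finset.prod_nonneg fun b _ => ha _
    _ = (∑ j ∈ t, a j) ^ i := by rw [← Finset.prod_univ_sum]; simp
    _ ≤ (∑' j, a j) ^ i := by
        gcongr
        · exact Finset.sum_nonneg fun j _ => ha j
        · exact hs.sum_le_tsum _ fun j _ => ha j

variable {N N' : ℕ} (T : H →L[ℝ] Euc N) (D : Euc N' →L[ℝ] Y) {i : ℕ}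

theorem norm_sq_comp_stdBasis_le (M : ContinuousMultilinearMap ℝ (fun _ : Fin i => Euc N) (Euc N'))
    (j : Fin i → BasisIndex H) :
    ‖D.compContinuousMultilinearMap (M.compContinuousLinearMap fun _ => T)
      (fun a => stdBasis H (j a))‖ ^ 2 ≤
        (‖D‖ * ‖M‖) ^ 2 * ∏ a, ‖T (stdBasis H (j a))‖ ^ 2 := by
  rw [Finset.prod_pow, ← mul_pow, mul_assoc]
  gcongr
  exact (D.le_opNorm _).trans (by gcongr; exact M.le_opNorm _)

theorem memlp_comp (M : ContinuousMultilinearMap ℝ (fun _ : Fin i => Euc N) (Euc N')) :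
    D.compContinuousMultilinearMap (M.compContinuousLinearMap fun _ => T) ∈ hsSubmodule H Y i := by
  change Memℓp _ 2
  refine memℓp_gen ?_
  simp only [ENNReal.toReal_ofNat, Real.rpow_ofNat]
  refine Summable.of_nonneg_of_le (fun _ => by positivity)
    (fun j => norm_sq_comp_stdBasis_le T D M j) (Summable.mul_left _ ?_)
  exact summable_of_sum_le (fun _ => by positivity) fun s =>
    sum_prod_le_tsum_pow (fun _ => by positivity) (summable_norm_sq_stdBasis T) i s

/-- The linear map `M ↦ D ∘ M ∘ (T × ⋯ × T)` from multilinear maps between Euclidean spaces to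
Hilbert-Schmidt multilinear maps. -/
noncomputable def hsComp :
    ContinuousMultilinearMap ℝ (fun _ : Fin i => Euc N) (Euc N') →ₗ[ℝ] HSMultilinear H Y i where
  toFun M := ⟨D.compContinuousMultilinearMap (M.compContinuousLinearMap fun _ => T),
    memlp_comp T D M⟩
  map_add' M M' := Subtype.ext <| by
    ext m
    exact map_add D _ _
  map_smul' c M := Subtype.ext <| by
    ext m
    exact map_smul D _ _

variable (i) in
theorem exists_norm_hsComp_le :
    ∃ C : ℝ, ∀ M : ContinuousMultilinearMap ℝ (fun _ : Fin i => Euc N) (Euc N'),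
      ‖hsComp T D M‖ ≤ C * ‖M‖ := by
  have hnn : 0 ≤ ∑' j, ‖T (stdBasis H j)‖ ^ 2 := tsum_nonneg fun _ => by positivity
  refine ⟨‖D‖ * √((∑' j, ‖T (stdBasis H j)‖ ^ 2) ^ i), fun M => ?_⟩
  refine abs_le_of_sq_le_sq' ?_ (by positivity) |>.2
  rw [HSMultilinear.norm_sq_eq]
  refine Real.tsum_le_of_sum_le (fun _ => by positivity) fun s => ?_
  calc ∑ j ∈ s, ‖(hsComp T D M).toMultilinear (fun a => stdBasis H (j a))‖ ^ 2
      ≤ ∑ j ∈ s, (‖D‖ * ‖M‖) ^ 2 * ∏ a, ‖T (stdBasis H (j a))‖ ^ 2 :=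
        Finset.sum_le_sum fun j _ => norm_sq_comp_stdBasis_le T D M j
    _ ≤ (‖D‖ * ‖M‖) ^ 2 * (∑' j, ‖T (stdBasis H j)‖ ^ 2) ^ i := by
        rw [← Finset.mul_sum]
        gcongr
        exact sum_prod_le_tsum_pow (fun _ => by positivity) (summable_norm_sq_stdBasis T) i s
    _ = (‖D‖ * √((∑' j, ‖T (stdBasis H j)‖ ^ 2) ^ i) * ‖M‖) ^ 2 := by
        rw [mul_pow, mul_pow, mul_pow, Real.sq_sqrt (by positivity)]
        ring

theorem continuous_hsComp : Continuous (hsComp T D (i := i)) := by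
  obtain ⟨C, hC⟩ := exists_norm_hsComp_le T D i
  exact AddMonoidHomClass.continuous_of_bound (hsComp T D (i := i)) C hC

end FiniteRank

/-! ### Jets of cylindrical maps -/

section Jets

variable {X : Type*} [NormedAddCommGroup X] [NormedSpace ℝ X] [CompleteSpace X]
  [MeasurableSpace X] [BorelSpace X]
variable {Y : Type*} [NormedAddCommGroup Y] [InnerProductSpace ℝ Y]
variable {γ : Measure X} [IsGaussian γ] {k : ℕ} {p : ℝ≥0∞}
variable {N N' : ℕ} (E : X →L[ℝ] Euc N) (D : Euc N' →L[ℝ] Y) {f : Euc N → Euc N'}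

/-- The chain rule for the derivatives of a cylindrical map along the Cameron-Martin space. -/
theorem iteratedFDeriv_cylMap (hf : ContDiff ℝ k f) {i : ℕ} (hi : i ≤ k) (x : X) :
    (iteratedFDeriv ℝ i (cylMap E D f) x).compContinuousLinearMap
      (fun _ => cameronMartinIncl γ) =
    (hsComp (E.comp (cameronMartinIncl γ)) D (iteratedFDeriv ℝ i f (E x))).toMultilinear := by
  have hik : (i : WithTop ℕ∞) ≤ k := by exact_mod_cast hi
  have h1 : iteratedFDeriv ℝ i (cylMap E D f) x =
      D.compContinuousMultilinearMap
        ((iteratedFDeriv ℝ i f (E x)).compContinuousLinearMap fun _ => E) := by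
    have h0 : cylMap E D f = D ∘ (f ∘ E) := rfl
    rw [h0, ContinuousLinearMap.iteratedFDeriv_comp_left D
      (hf.comp E.contDiff).contDiffAt hik, E.iteratedFDeriv_comp_right hf x hik]
  rw [h1]
  rfl

/-- The jet of a cylindrical map is the pointwise image of the finite-dimensional derivatives under
the linear maps `hsComp`. -/
theorem isJetOf_cylMap_iff (hf : ContDiff ℝ k f) {w : JetSpace Y γ k p} :
    IsJetOf w (cylMap E D f) ↔ ∀ i : Fin (k + 1), ∀ᵐ x ∂γ, w i x =
      hsComp (E.comp (cameronMartinIncl γ)) D (iteratedFDeriv ℝ (i : ℕ) f (E x)) := by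
  refine forall_congr' fun i => eventually_congr (Eventually.of_forall fun x => ?_)
  rw [iteratedFDeriv_cylMap E D hf i.is_le]
  exact Subtype.ext_iff.symm

/-- Passing to the jet of a cylindrical map is bounded: `E ∘ ι` is Hilbert-Schmidt, so the
`L^p` norm of `D_γ^i (D ∘ f ∘ E)` is controlled by the Sobolev norm of `f` for the law of `E`. -/
theorem exists_eLpNorm_hsComp_le :
    ∃ C : ℝ, 0 ≤ C ∧ ∀ i ≤ k, ∀ h : Euc N → ContinuousMultilinearMap ℝ (fun _ : Fin i => Euc N)
      (Euc N'), Continuous h →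
        eLpNorm (fun x => hsComp (E.comp (cameronMartinIncl γ)) D (h (E x))) p γ ≤
          ENNReal.ofReal C * eLpNorm h p (γ.map E) := by
  choose C hC using exists_norm_hsComp_le (E.comp (cameronMartinIncl γ)) D
  refine ⟨∑ i ∈ Finset.range (k + 1), |C i|, Finset.sum_nonneg fun _ _ => abs_nonneg _,
    fun i hi h hh => ?_⟩
  rw [eLpNorm_map_measure hh.aestronglyMeasurable E.continuous.measurable.aemeasurable]
  refine eLpNorm_le_mul_eLpNorm_of_ae_le_mul (ae_of_all _ fun x => (hC i _).trans ?_) p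
  refine mul_le_mul_of_nonneg_right ((le_abs_self _).trans ?_) (norm_nonneg _)
  exact Finset.single_le_sum (f := fun i => |C i|) (fun _ _ => abs_nonneg _)
    (Finset.mem_range.2 (Nat.lt_succ_of_le hi))

theorem exists_isJetOf_cylMap (hf : MemSobolev k p (γ.map E) f) :
    ∃ w : JetSpace Y γ k p, IsJetOf w (cylMap E D f) := by
  obtain ⟨C, -, hC⟩ := exists_eLpNorm_hsComp_le (γ := γ) (k := k) (p := p) E D
  have hcont : ∀ i : Fin (k + 1), Continuous (iteratedFDeriv ℝ (i : ℕ) f) := fun i =>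
    hf.1.continuous_iteratedFDeriv (by exact_mod_cast i.is_le)
  have hmem : ∀ i : Fin (k + 1), MemLp (fun x => hsComp (E.comp (cameronMartinIncl γ)) D
      (iteratedFDeriv ℝ (i : ℕ) f (E x))) p γ := fun i => by
    refine ⟨?_, (hC i i.is_le _ (hcont i)).trans_lt (ENNReal.mul_lt_top ENNReal.ofReal_lt_top
      ((eLpNorm_iteratedFDeriv_le_sobolevNorm f i.is_le).trans_lt hf.2))⟩
    exact (((continuous_hsComp _ D).comp (hcont i)).stronglyMeasurable.comp_measurable
      E.continuous.measurable).aestronglyMeasurable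
  exact ⟨fun i => (hmem i).toLp _, (isJetOf_cylMap_iff E D hf.1).2 fun i => (hmem i).coeFn_toLp⟩

variable [Fact (1 ≤ p)]

/-- The distance between the jets of two cylindrical maps with the same encoder and decoder is
bounded by the Sobolev distance of the maps between Euclidean spaces. -/
theorem exists_norm_sub_le_of_isJetOf :
    ∃ C : ℝ, 0 ≤ C ∧ ∀ {f g : Euc N → Euc N'}, ContDiff ℝ k f → ContDiff ℝ k g →
      ∀ {u w : JetSpace Y γ k p}, IsJetOf u (cylMap E D f) → IsJetOf w (cylMap E D g) →
        ∀ {ε : ℝ}, 0 ≤ ε →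
          sobolevNorm k p (γ.map E) (fun x => f x - g x) ≤ ENNReal.ofReal ε →
            ‖u - w‖ ≤ C * ε := by
  obtain ⟨C, hC0, hC⟩ := exists_eLpNorm_hsComp_le (γ := γ) (k := k) (p := p) E D
  refine ⟨C, hC0, fun {f g} hf hg {u w} hu hw {ε} hε hfg => ?_⟩
  rw [isJetOf_cylMap_iff E D hf] at hu
  rw [isJetOf_cylMap_iff E D hg] at hw
  refine (pi_norm_le_iff_of_nonneg (by positivity)).2 fun i => ?_
  rw [Pi.sub_apply, Lp.norm_def]
  refine ENNReal.toReal_le_of_le_ofReal (by positivity) ?_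
  have hae : (u i - w i : Lp _ p γ) =ᵐ[γ] fun x => hsComp (E.comp (cameronMartinIncl γ)) D
      (iteratedFDeriv ℝ (i : ℕ) (fun x => f x - g x) (E x)) := by
    filter_upwards [Lp.coeFn_sub (u i) (w i), hu i, hw i] with x h1 h2 h3
    rw [h1, Pi.sub_apply, h2, h3, iteratedFDeriv_fun_sub hf hg i.is_le, map_sub]
  rw [eLpNorm_congr_ae hae, ENNReal.ofReal_mul hC0]
  refine (hC i i.is_le _ ((hf.sub hg).continuous_iteratedFDeriv
    (by exact_mod_cast i.is_le))).trans ?_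
  gcongr
  exact (eLpNorm_iteratedFDeriv_le_sobolevNorm _ i.is_le).trans hfg

/-- The jet of a cylindrical map of finite Sobolev norm lies in the Gaussian Sobolev space. -/
theorem mem_gaussianSobolev_of_isJetOf (hp : p ≠ ∞) (hf : MemSobolev k p (γ.map E) f)
    {w : JetSpace Y γ k p} (hw : IsJetOf w (cylMap E D f)) : w ∈ gaussianSobolev Y γ k p := by
  have hfin : IsFiniteMeasure (γ.map E) := inferInstance
  obtain ⟨C, hC0, hC⟩ := exists_norm_sub_le_of_isJetOf (γ := γ) (k := k) (p := p) E D
  refine Metric.mem_closure_iff.2 fun ε hε => ?_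
  -- `C` may vanish, hence the denominator `C + 1`.
  have hδ : 0 < ε / (C + 1) := by positivity
  obtain ⟨g, hg, hgf⟩ := hf.exists_isSmoothBounded Fact.out hp (ENNReal.ofReal_pos.2 hδ).ne'
  have hgS : MemSobolev k p (γ.map E) g := hg.memSobolev
  obtain ⟨u, hu⟩ := exists_isJetOf_cylMap (γ := γ) E D hgS
  refine ⟨u, ⟨_, ⟨N, N', E, D, g, hg, rfl⟩, hu⟩, ?_⟩
  rw [dist_comm, dist_eq_norm]
  refine (hC hgS.1 hf.1 hu hw hδ.le hgf).trans_lt ?_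
  rw [← mul_div_assoc, div_lt_iff₀ (by positivity)]
  nlinarith

end Jets

end GaussianUA

theorem corollary4p6
    {X : Type*} [NormedAddCommGroup X] [NormedSpace ℝ X] [CompleteSpace X]
    [MeasurableSpace X] [BorelSpace X]
    {Y : Type*} [NormedAddCommGroup Y] [InnerProductSpace ℝ Y] [CompleteSpace Y]
    (μ₀ : Measure X) [IsGaussian μ₀]
    (k : ℕ) (p : ℝ≥0∞) [Fact (1 ≤ p)] (hp : p ≠ ∞)
    {Θ : ℕ → ℕ → Type*} (f : ∀ N N' : ℕ, Θ N N' → GaussianUA.Euc N → GaussianUA.Euc N')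
    (hf : GaussianUA.FinDimSobolevDensity k p f) :
    (∀ (N N' : ℕ) (E : X →L[ℝ] GaussianUA.Euc N) (D : GaussianUA.Euc N' →L[ℝ] Y) (θ : Θ N N'),
      GaussianUA.MemSobolev k p (μ₀.map E) (f N N' θ) →
        ∃ w ∈ GaussianUA.gaussianSobolev Y μ₀ k p,
          GaussianUA.IsJetOf w (GaussianUA.cylMap E D (f N N' θ))) ∧
    (∀ w ∈ GaussianUA.gaussianSobolev Y μ₀ k p, ∀ ε : ℝ, 0 < ε →
      ∃ F ∈ GaussianUA.encoderDecoder X Y f, ∃ u ∈ GaussianUA.gaussianSobolev Y μ₀ k p,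
        GaussianUA.IsJetOf u F ∧ ‖w - u‖ < ε) := by
  refine ⟨fun N N' E D θ hθ => ?_, fun w hw ε hε => ?_⟩
  · obtain ⟨w, hw⟩ := GaussianUA.exists_isJetOf_cylMap (γ := μ₀) E D hθ
    exact ⟨w, GaussianUA.mem_gaussianSobolev_of_isJetOf E D hp hθ hw, hw⟩
  · obtain ⟨v, ⟨_, ⟨N, N', E, D, g, hg, rfl⟩, hv⟩, hwv⟩ :=
      Metric.mem_closure_iff.1 hw (ε / 2) (half_pos hε)
    have hfin : IsFiniteMeasure (μ₀.map E) := inferInstance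
    obtain ⟨C, hC0, hC⟩ :=
      GaussianUA.exists_norm_sub_le_of_isJetOf (γ := μ₀) (k := k) (p := p) E D
    have hδ : 0 < ε / 2 / (C + 1) := by positivity
    have hgS : GaussianUA.MemSobolev k p (μ₀.map E) g := hg.memSobolev
    obtain ⟨θ, hθ⟩ := hf.approx N N' (μ₀.map E) hfin g hgS _ hδ
    have hθS : GaussianUA.MemSobolev k p (μ₀.map E) (f N N' θ) :=
      hgS.of_sub Fact.out (hf.contDiff N N' θ) (hθ.trans_le le_top)
    obtain ⟨u, hu⟩ := GaussianUA.exists_isJetOf_cylMap (γ := μ₀) E D hθS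
    refine ⟨_, ⟨N, N', E, D, θ, rfl⟩, u,
      GaussianUA.mem_gaussianSobolev_of_isJetOf E D hp hθS hu, hu, ?_⟩
    have h1 : ‖v - u‖ < ε / 2 := by
      refine (hC hgS.1 (hf.contDiff N N' θ) hv hu hδ.le hθ.le).trans_lt ?_
      rw [← mul_div_assoc, div_lt_iff₀ (by positivity)]
      nlinarith
    rw [dist_eq_norm] at hwv
    calc ‖w - u‖ ≤ ‖w - v‖ + ‖v - u‖ := norm_sub_le_norm_sub_add_norm_sub _ _ _
      _ < ε := by linarith
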